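/- Let $A$ be a finite alphabet and let $\sigma$ be the shift on $A^{\mathbb Z}$, $(\sigma x)_n=x_{n+1}$. For $x\in A^{\mathbb Z}$ and $r\ge 1$ put $$\mathrm{Per}_r(x)=\{n\in\mathbb Z:\ x_m=x_n\ \text{for all } m\equiv n \ (\mathrm{mod}\ r)\}.$$ The $r$-skeleton of $x$ is obtained from $x$ by replacing $x_n$ by a new symbol for every $n\notin \mathrm{Per}_r(x)$. The integer $r\ge 1$ is an essential period of $x$ if the $r$-skeleton of $x$ is not periodic with any smaller period. A period structure of $x$ is a sequence $(r_i)_{i\ge1}$ of essential periods of $x$ with $r_i\mid r_{i+1}$ for all $i\geq 1$ and $\bigcup_{i\ge1}\mathrm{Per}_{r_i}(x)=\mathbb Z$. A sequence $x$ is a Toeplitz sequence if it is not periodic and has a period structure, and a Toeplitz shift is the closure $X=\overline{\{\sigma^n z:n\in\mathbb Z\}}$ of the orbit of a Toeplitz sequence $z$, with the action of $\sigma$. The essential period of a block $x_0x_1\cdots x_{N-1}$ of $x$ is the least common multiple of essential periods of its letters, i.e. the smallest integer of the form $\mathrm{lcm}(e_0,\dots,e_{N-1})$, where each $e_n$ is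 an essential period of $x$ with $n\in \mathrm{Per}_{e_n}(x)$ (equivalently, the smallest $P\geq 1$ with $\{0,\dots,N-1\}\subseteq \mathrm{Per}_P(x)$). A period structure $(r_i)_{i\ge1}$ of $x$ is constructive if, for every $i\ge1$, the initial block $x_0\cdots x_{r_i-1}$ has essential period $r_{i+1}$. **Theorem 1.1.** Let $(X,\sigma)$ and $(Y,\sigma)$ be Toeplitz shifts over finite alphabets, let $x\in X$ and $y\in Y$ be Toeplitz sequences, and let $p,q$ be positive integers such that $(p^i)_{i\ge1}$ and $(q^i)_{i\ge1}$ (the sequences of powers of $p$ and of $q$) are constructive period structures of $x$ and $y$, respectively. If there is a topological factor map $\pi:(X,\sigma)\to(Y,\sigma)$, i.e. a continuous surjection with $\pi\circ\sigma=\sigma\circ\pi$, such that $\pi(x)=y$, then $q\mid p$. In particular, if there is a topological conjugacy $\pi:(X,\sigma)\to(Y,\sigma)$, i.e. a homeomorphism with $\pi\circ\sigma=\sigma\circ\pi$, such that $\pi(x)=y$, then $p=q$. -/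

import Mathlib

open SymbolicDynamics.FullShift

namespace ToeplitzShift

/-- A bi-infinite sequence is aperiodic if it has no positive period. -/
def Aperiodic {A : Type*} (x : ℤ → A) : Prop :=
  ¬ ∃ n : ℕ, 0 < n ∧ Function.Periodic x (n : ℤ)

/-- `Per_p(x, a)`: the positions whose whole residue class modulo `p` carries the letter `a`. -/
def perLetter {A : Type*} (p : ℕ) (x : ℤ → A) (a : A) : Set ℤ :=
  {n | ∀ m : ℤ, m ≡ n [ZMOD p] → x m = a}

/-- `Per_p(x)`, the union of the sets `Per_p(x, a)` over all letters `a`. -/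
def per {A : Type*} (p : ℕ) (x : ℤ → A) : Set ℤ :=
  ⋃ a : A, perLetter p x a

open Classical in
/-- The `p`-skeleton of `x`: the letters outside `Per_p(x)` are replaced by a new symbol,
here `none`. -/
noncomputable def skeleton {A : Type*} (p : ℕ) (x : ℤ → A) : ℤ → Option A :=
  fun n => if n ∈ per p x then some (x n) else none

/-- `p` is an essential period of `x` if `p` is positive and the `p`-skeleton of `x` is not
periodic with any smaller (positive) period. -/
def IsEssentialPeriod {A : Type*} (x : ℤ → A) (p : ℕ) : Prop :=
  0 < p ∧ ∀ r : ℕ, 0 < r → r < p → ¬ Function.Periodic (skeleton p x) (r : ℤ)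

/-- `(P i)_{i ≥ 1}` is a period structure of `x`. The value `P 0` plays no role. -/
structure IsPeriodStructure {A : Type*} (x : ℤ → A) (P : ℕ → ℕ) : Prop where
  essential : ∀ i, 1 ≤ i → IsEssentialPeriod x (P i)
  dvd_succ : ∀ i, 1 ≤ i → P i ∣ P (i + 1)
  iUnion_per : ⋃ i : ℕ, ⋃ _ : 1 ≤ i, per (P i) x = Set.univ

/-- A Toeplitz sequence is an aperiodic sequence that has a period structure. -/
def IsToeplitzSequence {A : Type*} (x : ℤ → A) : Prop :=
  Aperiodic x ∧ ∃ P : ℕ → ℕ, IsPeriodStructure x P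

/-- `P` is the essential period of the initial block `x_0 ⋯ x_{N-1}` of `x`: the smallest number
that is the least common multiple of essential periods `e 0, …, e (N-1)` of its letters, where
`e n` is an essential period of the letter at position `n` if `n ∈ Per_{e n}(x)`. -/
def IsBlockEssentialPeriod {A : Type*} (x : ℤ → A) (N P : ℕ) : Prop :=
  IsLeast {L : ℕ | ∃ e : ℕ → ℕ,
    (∀ n < N, IsEssentialPeriod x (e n) ∧ (n : ℤ) ∈ per (e n) x) ∧
      L = (Finset.range N).lcm e} P

/-- The period structure `(P i)_{i ≥ 1}` of `x` is constructive if for every `i ≥ 1` the initial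
block of `x` of length `P i` has essential period `P (i + 1)`. -/
structure IsConstructive {A : Type*} (x : ℤ → A) (P : ℕ → ℕ) : Prop where
  periodStructure : IsPeriodStructure x P
  block : ∀ i, 1 ≤ i → IsBlockEssentialPeriod x (P i) (P (i + 1))

/-- A Toeplitz shift is the closure of the two-sided shift orbit of a Toeplitz sequence. -/
def IsToeplitzShift {A : Type*} [TopologicalSpace A] (X : Subshift A ℤ) : Prop :=
  ∃ z : ℤ → A, IsToeplitzSequence z ∧
    X.carrier = closure (Set.range fun n : ℤ => shift n z)

/-- The shift map `σ`, `(σ x)_n = x_{n+1}`, on a subshift. -/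
def shiftMap {A : Type*} [TopologicalSpace A] (X : Subshift A ℤ) : X.carrier → X.carrier :=
  (X.mapsTo 1).restrict (shift 1) X.carrier X.carrier

/-- Topological factor maps `(X, σ) → (Y, σ)`. -/
structure IsFactorMap {A B : Type*} [TopologicalSpace A] [TopologicalSpace B]
    (X : Subshift A ℤ) (Y : Subshift B ℤ) (π : X.carrier → Y.carrier) : Prop where
  continuous : Continuous π
  surjective : Function.Surjective π
  semiconj : Function.Semiconj π (shiftMap X) (shiftMap Y)

/-- Topological conjugacies `(X, σ) → (Y, σ)`. -/
structure IsConjugacy {A B : Type*} [TopologicalSpace A] [TopologicalSpace B]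
    (X : Subshift A ℤ) (Y : Subshift B ℤ) (π : X.carrier → Y.carrier) : Prop where
  homeomorph : IsHomeomorph π
  semiconj : Function.Semiconj π (shiftMap X) (shiftMap Y)

end ToeplitzShift

namespace ToeplitzShift

variable {A B : Type*}

/-! A factor map is a sliding block code, so for large `i` the inclusion of `[0, p^i)` in
`Per_{p^(i+1)}` passes from `x` to `y`. Thus `y` is covered along powers of both `p` and `q`.

Take `q^j ≤ p^i < q^(j+1)` and `d_i = gcd(p^(i+1), q^(j+1))`. Then `y` has period `d_i` on `[0,
q^j)` (`eq_of_modEq_gcd`). If `d_i` were eventually small against `q^j`, overlaps would propagate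
one period to all of `y` (`nat_periodic_of_overlap`), against aperiodicity. So infinitely often both
powers are bounded multiples of `d_i`, and pigeonhole gives `p^s = q^t`.

At a common power, minimality of the block's essential period gives `q ≤ p`. Hence `s ≤ t`, so `q^t
= p^s` divides `p^t` and `q ∣ p`. A conjugacy gives this in both directions. -/

theorem mem_per_iff {r : ℕ} {x : ℤ → A} {n : ℤ} :
    n ∈ per r x ↔ ∀ m : ℤ, m ≡ n [ZMOD r] → x m = x n := by
  simp only [per, perLetter, Set.mem_iUnion, Set.mem_ofPred_eq]
  constructor
  · rintro ⟨a, h⟩ m hm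
    rw [h m hm, h n rfl]
  · exact fun h => ⟨x n, h⟩

theorem per_mono {r s : ℕ} (h : r ∣ s) (x : ℤ → A) : per r x ⊆ per s x := fun _ hn =>
  mem_per_iff.2 fun m hm => mem_per_iff.1 hn m (hm.of_dvd (Int.natCast_dvd_natCast.2 h))

theorem mem_per_of_modEq {r : ℕ} {x : ℤ → A} {m n : ℤ} (hn : n ∈ per r x)
    (h : m ≡ n [ZMOD r]) : m ∈ per r x :=
  mem_per_iff.2 fun k hk => by
    rw [mem_per_iff.1 hn k (hk.trans h), mem_per_iff.1 hn m h]

/-- By Bézout some position is congruent to `a` mod `P` and to `b` mod `Q`; its letter equals both.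
-/
theorem eq_of_modEq_gcd {P Q : ℕ} {x : ℤ → A} {a b : ℤ} (ha : a ∈ per P x) (hb : b ∈ per Q x)
    (h : a ≡ b [ZMOD (P.gcd Q : ℕ)]) : x a = x b := by
  obtain ⟨k, hk⟩ := h.dvd
  rw [Nat.gcd_eq_gcd_ab] at hk
  have h1 := mem_per_iff.1 ha (a + P * (P.gcdA Q * k))
    (Int.modEq_iff_dvd.2 ⟨-(P.gcdA Q * k), by ring⟩)
  have h2 := mem_per_iff.1 hb (a + P * (P.gcdA Q * k))
    (Int.modEq_iff_dvd.2 ⟨P.gcdB Q * k, by linear_combination hk⟩)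
  rw [← h1, h2]

/-! ### Skeletons and essential periods -/

theorem skeleton_of_mem {r : ℕ} {x : ℤ → A} {n : ℤ} (h : n ∈ per r x) :
    skeleton r x n = some (x n) := if_pos h

theorem skeleton_of_notMem {r : ℕ} {x : ℤ → A} {n : ℤ} (h : n ∉ per r x) :
    skeleton r x n = none := if_neg h

theorem skeleton_periodic (r : ℕ) (x : ℤ → A) : Function.Periodic (skeleton r x) (r : ℤ) := by
  intro n
  have hmod : n + r ≡ n [ZMOD r] := Int.modEq_iff_dvd.2 ⟨-1, by ring⟩
  by_cases h : n ∈ per r x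
  · rw [skeleton_of_mem h, skeleton_of_mem (mem_per_of_modEq h hmod), mem_per_iff.1 h _ hmod]
  · rw [skeleton_of_notMem h,
      skeleton_of_notMem fun h' => h (mem_per_of_modEq h' hmod.symm)]

theorem mem_per_of_skeleton_periodic {L e : ℕ} {x : ℤ → A}
    (h : Function.Periodic (skeleton L x) (e : ℤ)) {n : ℤ} (hn : n ∈ per L x) :
    n ∈ per e x := by
  refine mem_per_iff.2 fun m hm => ?_
  obtain ⟨k, hk⟩ := hm.dvd
  have h1 : skeleton L x m = some (x n) := by
    rw [← skeleton_of_mem hn, ← h.int_mul k m]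
    congr 1
    linear_combination -hk
  by_cases hm' : m ∈ per L x
  · rw [skeleton_of_mem hm'] at h1
    exact Option.some.inj h1
  · rw [skeleton_of_notMem hm'] at h1
    cases h1

/-- Every position of `Per_L(x)` lies in `Per_e(x)` for an essential period `e` dividing `L`. -/
theorem exists_essentialPeriod {L : ℕ} (hL : 0 < L) (x : ℤ → A) :
    ∃ e, IsEssentialPeriod x e ∧ e ∣ L ∧ per L x ⊆ per e x := by
  classical
  have hex : ∃ e : ℕ, 0 < e ∧ Function.Periodic (skeleton L x) (e : ℤ) :=
    ⟨L, hL, skeleton_periodic L x⟩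
  obtain ⟨he, hper⟩ := Nat.find_spec hex
  have hmin : ∀ r : ℕ, 0 < r → r < Nat.find hex → ¬ Function.Periodic (skeleton L x) (r : ℤ) :=
    fun r hr hlt hp => Nat.find_min hex hlt ⟨hr, hp⟩
  generalize Nat.find hex = e at he hper hmin
  have hdvd : e ∣ L := by
    -- Otherwise the remainder `L % e` would be a smaller period of the skeleton.
    by_contra hnd
    refine hmin (L % e) (Nat.pos_of_ne_zero fun h => hnd (Nat.dvd_of_mod_eq_zero h))
      (Nat.mod_lt _ he) ?_
    have h := (skeleton_periodic L x).sub_period (hper.int_mul (L / e : ℕ))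
    have hcast : ((L % e : ℕ) : ℤ) = (L : ℤ) - ((L / e : ℕ) : ℤ) * e := by
      have h' := Nat.mod_add_div L e
      have h'' : ((L % e : ℕ) : ℤ) + e * (L / e : ℕ) = L := by exact_mod_cast h'
      linear_combination h''
    rw [hcast]
    exact h
  have hsub : per L x ⊆ per e x := fun n hn => mem_per_of_skeleton_periodic hper hn
  have hskel : skeleton e x = skeleton L x := by
    funext n
    by_cases hn : n ∈ per L x
    · rw [skeleton_of_mem hn, skeleton_of_mem (hsub hn)]
    · rw [skeleton_of_notMem hn, skeleton_of_notMem fun h => hn (per_mono hdvd x h)]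
  exact ⟨e, ⟨he, fun r hr hlt => hskel ▸ hmin r hr hlt⟩, hdvd, hsub⟩

theorem IsBlockEssentialPeriod.mem_per {x : ℤ → A} {N P : ℕ} (h : IsBlockEssentialPeriod x N P)
    {n : ℕ} (hn : n < N) : (n : ℤ) ∈ per P x := by
  obtain ⟨e, he, rfl⟩ := h.1
  exact per_mono (Finset.dvd_lcm (Finset.mem_range.2 hn)) x (he n hn).2

/-- One essential period dividing `L` serves all letters of the block, so minimality applies to any
`L`, essential or not. -/
theorem IsBlockEssentialPeriod.le {x : ℤ → A} {N P L : ℕ} (h : IsBlockEssentialPeriod x N P)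
    (hL : 0 < L) (hN : ∀ n < N, (n : ℤ) ∈ per L x) : P ≤ L := by
  obtain ⟨e, he, hdvd, hsub⟩ := exists_essentialPeriod hL x
  refine (h.2 ⟨fun _ => e, fun n hn => ⟨he, hsub (hN n hn)⟩, rfl⟩).trans
    (Nat.le_of_dvd hL (Finset.lcm_dvd fun _ _ => hdvd))

/-! ### Powers covering initial blocks -/

/-- The initial blocks of length `p ^ i` are eventually contained in `Per_{p ^ (i + 1)}(x)`. -/
def EventuallyCovers (x : ℤ → A) (p : ℕ) : Prop :=
  ∃ K : ℕ, ∀ i, K ≤ i → ∀ n < p ^ i, ((n : ℕ) : ℤ) ∈ per (p ^ (i + 1)) x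

theorem IsConstructive.eventuallyCovers {x : ℤ → A} {p : ℕ}
    (h : IsConstructive x fun i => p ^ i) : EventuallyCovers x p :=
  ⟨1, fun i hi _ hn => (h.block i hi).mem_per hn⟩

theorem IsConstructive.exists_mem_per {x : ℤ → A} {p : ℕ}
    (h : IsConstructive x fun i => p ^ i) (n : ℤ) : ∃ i, n ∈ per (p ^ i) x := by
  have hn : n ∈ ⋃ i : ℕ, ⋃ _ : 1 ≤ i, per (p ^ i) x := by
    rw [h.periodStructure.iUnion_per]
    trivial
  simp only [Set.mem_iUnion] at hn
  obtain ⟨i, -, hi⟩ := hn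
  exact ⟨i, hi⟩

theorem IsConstructive.two_le {x : ℤ → A} {p : ℕ} (hx : Aperiodic x)
    (h : IsConstructive x fun i => p ^ i) : 2 ≤ p := by
  have hpos : 0 < p := by
    have h1 := (h.periodStructure.essential 1 le_rfl).1
    simpa using h1
  by_contra hlt
  obtain rfl : p = 1 := by omega
  refine hx ⟨1, one_pos, fun n => ?_⟩
  obtain ⟨i, hi⟩ := h.exists_mem_per n
  rw [one_pow] at hi
  exact mem_per_iff.1 hi _ (by simp)

/-! ### From local periods to a global period -/

/-- If every position of `x` has a period among the powers of `q`, then a period of the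
nonnegative half of `x` is a period of `x`. -/
theorem periodic_of_nat_periodic {x : ℤ → A} {q D : ℕ} (hq : 0 < q)
    (hx : ∀ n : ℤ, ∃ i, n ∈ per (q ^ i) x) (hD : ∀ n : ℕ, x n = x (n + D)) :
    Function.Periodic x (D : ℤ) := by
  intro m
  obtain ⟨i, hi⟩ := hx m
  obtain ⟨j, hj⟩ := hx (m + D)
  have hi' := per_mono (pow_dvd_pow q (le_max_left i j)) x hi
  have hj' := per_mono (pow_dvd_pow q (le_max_right i j)) x hj
  generalize max i j = k at hi' hj'
  have hone : (1 : ℤ) ≤ ((q ^ k : ℕ) : ℤ) := by exact_mod_cast Nat.one_le_pow _ _ hq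
  -- Translating by `q^k * |m|` moves `m` into the nonnegative half without changing the letters at
  -- `m` and `m + D`.
  have hnn : 0 ≤ m + ((q ^ k : ℕ) : ℤ) * |m| := by
    nlinarith [abs_nonneg m, neg_abs_le m]
  obtain ⟨n, hn⟩ := Int.eq_ofNat_of_zero_le hnn
  have h1 := mem_per_iff.1 hi' n (Int.modEq_iff_dvd.2 ⟨-|m|, by rw [← hn]; ring⟩)
  have h2 := mem_per_iff.1 hj' (n + D) (Int.modEq_iff_dvd.2 ⟨-|m|, by rw [← hn]; ring⟩)
  rw [← h2, ← hD, h1]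

/-- A word whose initial blocks of lengths `N i → ∞` have periods `d i` with `d (i + 1)` and
`d 0` at most half of `N i` has period `d 0`. -/
theorem nat_periodic_of_overlap {x : ℤ → A} {N d : ℕ → ℕ} (hN : Monotone N)
    (hunb : ∀ n, ∃ i, n < N i) (hd0 : 2 * d 0 ≤ N 0) (hd : ∀ i, 2 * d (i + 1) < N i)
    (hpos : ∀ i, 0 < d i)
    (hx : ∀ i, ∀ a < N i, ∀ b < N i, a ≡ b [MOD d i] → x (a : ℕ) = x (b : ℕ)) (n : ℕ) :
    x n = x (n + d 0) := by
  have key : ∀ i, ∀ n, n + d 0 < N i → x (n : ℕ) = x ((n + d 0 : ℕ) : ℤ) := by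
    intro i
    induction i with
    | zero =>
      intro n hn
      exact hx 0 _ (by omega) _ hn (by simp [Nat.ModEq])
    | succ i ih =>
      intro n hn
      have h0 : N 0 ≤ N i := hN (Nat.zero_le i)
      have h1 : N i ≤ N (i + 1) := hN (Nat.le_succ i)
      have h2 := hd i
      have h3 := Nat.mod_lt n (hpos (i + 1))
      have h4 := Nat.mod_le n (d (i + 1))
      have hmod : n % d (i + 1) ≡ n [MOD d (i + 1)] := Nat.mod_modEq _ _
      -- The residue is below `N i / 2` and `d 0 ≤ N i / 2`, so the residue and its translate by `d
      -- 0` both lie in the previous block.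
      rw [← hx (i + 1) (n % d (i + 1)) (by omega) n (by omega) hmod,
        ih (n % d (i + 1)) (by omega)]
      exact hx (i + 1) _ (by omega) _ hn (hmod.add_right _)
  obtain ⟨i, hi⟩ := hunb (n + d 0)
  exact_mod_cast key i n hi

/-! ### Multiplicative dependence and divisibility -/

/-- If the powers of `p` and `q` are infinitely often, up to a bounded factor, equal to a common
divisor, then `p` and `q` are multiplicatively dependent. -/
theorem exists_pow_eq_pow {p q C : ℕ} (hp : 0 < p) (hq : 0 < q) {j : ℕ → ℕ} (hj : Monotone j)
    {S : Set ℕ} (hS : S.Infinite)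
    (hle : ∀ i ∈ S, p ^ (i + 1) ≤ C * (p ^ (i + 1)).gcd (q ^ (j i + 1)) ∧
      q ^ (j i + 1) ≤ C * (p ^ (i + 1)).gcd (q ^ (j i + 1))) :
    ∃ s t, 0 < s ∧ p ^ s = q ^ t := by
  let d : ℕ → ℕ := fun i => (p ^ (i + 1)).gcd (q ^ (j i + 1))
  let f : ℕ → ℕ × ℕ := fun i => (p ^ (i + 1) / d i, q ^ (j i + 1) / d i)
  have hmaps : Set.MapsTo f S (Set.Iic C ×ˢ Set.Iic C) := fun i hi =>
    ⟨Nat.div_le_of_le_mul (by rw [mul_comm]; exact (hle i hi).1),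
      Nat.div_le_of_le_mul (by rw [mul_comm]; exact (hle i hi).2)⟩
  -- Pigeonhole on the cofactors of the gcd: equal cofactors at `a` and `b` make the two power
  -- ratios equal.
  obtain ⟨a, -, b, -, hne, hab⟩ := hS.exists_ne_map_eq_of_mapsTo hmaps
    ((Set.finite_Iic C).prod (Set.finite_Iic C))
  wlog hlt : a < b generalizing a b
  · exact this b a hne.symm hab.symm (by omega)
  obtain ⟨h1, h2⟩ := Prod.mk.inj hab
  have e1 : ∀ i, p ^ (i + 1) / d i * d i = p ^ (i + 1) := fun i =>
    Nat.div_mul_cancel (Nat.gcd_dvd_left _ _)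
  have e2 : ∀ i, q ^ (j i + 1) / d i * d i = q ^ (j i + 1) := fun i =>
    Nat.div_mul_cancel (Nat.gcd_dvd_right _ _)
  have hprod : p ^ (a + 1) * q ^ (j b + 1) = p ^ (b + 1) * q ^ (j a + 1) := by
    rw [← e1 a, ← e1 b, ← e2 a, ← e2 b, h1, h2]
    ring
  have hjab := hj hlt.le
  refine ⟨b - a, j b - j a, by omega, ?_⟩
  have hb : b + 1 = (b - a) + (a + 1) := by omega
  have hjb : j b + 1 = (j b - j a) + (j a + 1) := by omega
  rw [hb, hjb, pow_add p (b - a), pow_add q (j b - j a)] at hprod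
  refine (Nat.eq_of_mul_eq_mul_right (m := p ^ (a + 1) * q ^ (j a + 1)) (by positivity) ?_).symm
  linarith

/-- An aperiodic sequence with `Per` sets covering initial blocks along powers of `p` and of `q`
forces `p` and `q` to be multiplicatively dependent. -/
theorem EventuallyCovers.exists_pow_eq_pow {x : ℤ → A} {p q : ℕ} (hx : Aperiodic x)
    (hp : 2 ≤ p) (hq : 2 ≤ q) (hper : ∀ n : ℤ, ∃ i, n ∈ per (q ^ i) x)
    (hpc : EventuallyCovers x p) (hqc : EventuallyCovers x q) :
    ∃ s t, 0 < s ∧ p ^ s = q ^ t := by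
  obtain ⟨K, hK⟩ := hpc
  obtain ⟨K', hK'⟩ := hqc
  let j : ℕ → ℕ := fun i => Nat.log q (p ^ i)
  have hj : Monotone j := fun a b hab => Nat.log_mono_right (Nat.pow_le_pow_right (by omega) hab)
  have hjle : ∀ i, q ^ j i ≤ p ^ i := fun i => Nat.pow_log_le_self q (by positivity)
  have hjlt : ∀ i, p ^ i < q ^ j i * q := fun i => by
    rw [← pow_succ]
    exact Nat.lt_pow_succ_log_self (by omega) _
  let d : ℕ → ℕ := fun i => (p ^ (i + 1)).gcd (q ^ (j i + 1))
  have hdpos : ∀ i, 0 < d i := fun i => Nat.gcd_pos_of_pos_left _ (by positivity)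
  -- The factor `p * q` absorbs the growth of `q ^ j i` from one `i` to the next; the `2` is the one
  -- in the overlap lemma.
  by_cases hS : {i | q ^ j i < 2 * p * q * d i}.Infinite
  · refine ToeplitzShift.exists_pow_eq_pow (C := 2 * p ^ 2 * q ^ 2) (by omega) (by omega) hj hS
      fun i hi => ?_
    change q ^ j i < 2 * p * q * d i at hi
    change p ^ (i + 1) ≤ 2 * p ^ 2 * q ^ 2 * d i ∧ q ^ (j i + 1) ≤ 2 * p ^ 2 * q ^ 2 * d i
    constructor
    · calc p ^ (i + 1) = p * p ^ i := by ring
        _ ≤ p * (q ^ j i * q) := by gcongr; exact (hjlt i).le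
        _ ≤ p * (2 * p * q * d i * q) := by gcongr
        _ = _ := by ring
    · calc q ^ (j i + 1) = 1 * (q * q ^ j i) := by ring
        _ ≤ p * (q * (2 * p * q * d i)) := by gcongr; omega
        _ = _ := by ring
  · exfalso
    obtain ⟨M, hM⟩ := (Set.not_infinite.1 hS).bddAbove
    have hgood : ∀ i, M < i → 2 * p * q * d i ≤ q ^ j i := fun i hi =>
      not_lt.1 fun h => absurd (hM h) (by omega)
    have hjunb : ∀ k, ∃ i, k ≤ j i := fun k => by
      obtain ⟨i, hi⟩ := pow_unbounded_of_one_lt (q ^ k) (show 1 < p by omega)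
      exact ⟨i, Nat.le_log_of_pow_le (by omega) hi.le⟩
    obtain ⟨I, hI⟩ := hjunb K'
    let c := M + 1 + K + I
    refine hx ⟨d (c + 0), hdpos _, periodic_of_nat_periodic (by omega : 0 < q) hper
      (nat_periodic_of_overlap (N := fun i => q ^ j (c + i)) (d := fun i => d (c + i))
        ?_ ?_ ?_ ?_ (fun i => hdpos _) ?_)⟩
    · exact fun a b hab => Nat.pow_le_pow_right (by omega) (hj (by omega))
    · intro n
      obtain ⟨i, hi⟩ := hjunb n
      refine ⟨i, (Nat.lt_pow_self (by omega : 1 < q)).trans_le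
        (Nat.pow_le_pow_right (by omega) (hi.trans (hj (by omega))))⟩
    · refine le_trans ?_ (hgood (c + 0) (by omega))
      have : 1 ≤ p * q := Nat.mul_pos (by omega) (by omega)
      nlinarith [Nat.mul_le_mul_right (2 * d (c + 0)) this]
    · intro i
      have h1 := hgood (c + i + 1) (by omega)
      have h2 := hjle (c + i + 1)
      have h3 := hjlt (c + i)
      have h4 : p * q * (2 * d (c + i + 1)) < p * q * q ^ j (c + i) := by
        calc p * q * (2 * d (c + i + 1)) = 2 * p * q * d (c + i + 1) := by ring
          _ ≤ p ^ (c + i + 1) := h1.trans h2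
          _ = p * p ^ (c + i) := by ring
          _ < p * (q ^ j (c + i) * q) := by gcongr
          _ = _ := by ring
      exact Nat.lt_of_mul_lt_mul_left h4
    · intro i a ha b hb hab
      refine eq_of_modEq_gcd (hK (c + i) (by omega) a (ha.trans_le (hjle _)))
        (hK' (j (c + i)) (hI.trans (hj (by omega))) b hb) ?_
      exact Int.natCast_modEq_iff.2 hab

/-- The combinatorial core: if the powers of `q` form a constructive period structure of `y`
and the powers of `p` eventually cover, then `q ∣ p`. -/
theorem IsConstructive.dvd_of_eventuallyCovers {y : ℤ → B} {p q : ℕ} (hy : Aperiodic y)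
    (hp : 2 ≤ p) (hq : IsConstructive y fun i => q ^ i) (hpc : EventuallyCovers y p) :
    q ∣ p := by
  have hq2 := hq.two_le hy
  obtain ⟨s, t, hs, hst⟩ := hpc.exists_pow_eq_pow hy hp hq2 hq.exists_mem_per hq.eventuallyCovers
  have ht : 0 < t := by
    refine Nat.pos_of_ne_zero fun h => ?_
    rw [h, pow_zero] at hst
    exact absurd hst (Nat.one_lt_pow hs.ne' (by omega)).ne'
  obtain ⟨K, hK⟩ := hpc
  have heq : p ^ (s * (K + 1)) = q ^ (t * (K + 1)) := by rw [pow_mul, pow_mul, hst]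
  -- The block of length `p^(s(K+1)) = q^(t(K+1))` is covered at the next power of `p`, while the
  -- next power of `q` is minimal.
  have hle : q ^ (t * (K + 1) + 1) ≤ p ^ (s * (K + 1) + 1) := by
    refine (hq.block (t * (K + 1)) (by nlinarith)).le (by positivity) fun n hn => ?_
    exact hK (s * (K + 1)) (by nlinarith) n (heq ▸ hn)
  have hqp : q ≤ p := by
    rw [pow_succ, pow_succ, heq] at hle
    exact Nat.le_of_mul_le_mul_left hle (by positivity)
  have hst' : s ≤ t := by
    have h : q ^ s ≤ q ^ t := hst ▸ Nat.pow_le_pow_left hqp s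
    exact (Nat.pow_le_pow_iff_right (by omega)).1 h
  exact (Nat.pow_dvd_pow_iff ht.ne').1 (hst ▸ pow_dvd_pow p hst')

/-! ### Factor maps are sliding block codes -/

section Topology

variable [TopologicalSpace A] [TopologicalSpace B]

theorem IsFactorMap.apply_shift {X : Subshift A ℤ} {Y : Subshift B ℤ}
    {π : X.carrier → Y.carrier} (h : IsFactorMap X Y π) (x : X.carrier) (n : ℤ) :
    (π ⟨shift n (x : ℤ → A), X.mapsTo n x.2⟩ : ℤ → B) = shift n (π x : ℤ → B) := by
  have step : ∀ z : X.carrier, (π ⟨shift 1 (z : ℤ → A), X.mapsTo 1 z.2⟩ : ℤ → B) =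
      shift 1 (π z : ℤ → B) := fun z => congrArg Subtype.val (h.semiconj z)
  have add : ∀ (k l : ℤ), shift l (shift k (x : ℤ → A)) = shift (k + l) (x : ℤ → A) :=
    fun k l => by funext m; simp [add_assoc]
  induction n using Int.induction_on with
  | zero => simp
  | succ k ih =>
    have h1 := step ⟨_, X.mapsTo k x.2⟩
    simp only [add] at h1
    rw [h1, ih]
    funext m
    simp [add_assoc]
  | pred k ih =>
    have h1 := step ⟨_, X.mapsTo (-k - 1) x.2⟩
    simp only [add, sub_add_cancel] at h1
    rw [ih] at h1
    funext m
    have h2 := congrFun h1 (m - 1)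
    simp only [shift_apply] at h2 ⊢
    rw [show (-(k : ℤ) - 1 + m) = -k + (m - 1) by ring, h2,
      show 1 + (m - 1) = m by ring]

/-- Curtis–Hedlund–Lyndon: the zeroth letter of the image is locally constant, and compactness of
`X` makes the window uniform. -/
theorem exists_window [Finite A] [DiscreteTopology A] [DiscreteTopology B]
    {X : Subshift A ℤ} {Y : Subshift B ℤ} {π : X.carrier → Y.carrier} (h : Continuous π) :
    ∃ F : Finset ℤ, ∀ z w : X.carrier, (∀ n ∈ F, (z : ℤ → A) n = (w : ℤ → A) n) →
      (π z : ℤ → B) 0 = (π w : ℤ → B) 0 := by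
  classical
  let f : X.carrier → B := fun z => (π z : ℤ → B) 0
  have hf : Continuous f := (continuous_apply 0).comp (continuous_subtype_val.comp h)
  have hloc : ∀ z : X.carrier, ∃ F : Finset ℤ, ∀ w : X.carrier,
      (∀ n ∈ F, (w : ℤ → A) n = (z : ℤ → A) n) → f w = f z := by
    intro z
    have hnhds : f ⁻¹' {f z} ∈ nhds z := hf.continuousAt ((isOpen_discrete _).mem_nhds rfl)
    obtain ⟨U, hU, hsub⟩ := mem_nhds_subtype _ _ _ |>.1 hnhds
    rw [nhds_pi, Filter.mem_pi'] at hU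
    obtain ⟨F, t, ht, htU⟩ := hU
    exact ⟨F, fun w hw => hsub (htU fun n hn => by rw [hw n hn]; exact mem_of_mem_nhds (ht n))⟩
  choose F hF using hloc
  have : CompactSpace X.carrier := isCompact_iff_compactSpace.1 X.isClosed.isCompact
  obtain ⟨s, -, hs⟩ := (isCompact_univ (X := X.carrier)).elim_nhds_subcover
    (fun z => Subtype.val ⁻¹' cylinder (F z) (z : ℤ → A)) fun z _ =>
      ((isOpen_cylinder (F z) (z : ℤ → A)).preimage continuous_subtype_val).mem_nhds
        (mem_cylinder.2 fun _ _ => rfl)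
  refine ⟨s.biUnion F, fun z w hzw => ?_⟩
  have hz := hs (Set.mem_univ z)
  simp only [Set.mem_iUnion, Set.mem_preimage, mem_cylinder] at hz
  obtain ⟨u, hu, hzu⟩ := hz
  exact (hF u z hzu).trans (hF u w fun n hn =>
    (hzw n (Finset.mem_biUnion.2 ⟨u, hu, hn⟩)).symm.trans (hzu n hn)).symm

theorem IsFactorMap.eventuallyCovers [Finite A] [DiscreteTopology A] [DiscreteTopology B]
    {X : Subshift A ℤ} {Y : Subshift B ℤ} {π : X.carrier → Y.carrier} (h : IsFactorMap X Y π)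
    {x : X.carrier} {p : ℕ} (hx : IsConstructive (x : ℤ → A) fun i => p ^ i) :
    EventuallyCovers (π x : ℤ → B) p := by
  obtain ⟨F, hF⟩ := exists_window h.continuous
  obtain ⟨M, hM⟩ : ∃ M : ℕ, ∀ s ∈ F, |s| ≤ M := by
    refine ⟨∑ s ∈ F, s.natAbs, fun s hs => ?_⟩
    rw [Int.abs_eq_natAbs]
    exact_mod_cast Finset.single_le_sum (f := Int.natAbs) (fun _ _ => Nat.zero_le _) hs
  choose e he using hx.exists_mem_per
  let K := (Finset.Icc (-(M : ℤ)) M).sup e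
  have hK : ∀ i, K ≤ i → ∀ s : ℤ, |s| ≤ M → s ∈ per (p ^ i) (x : ℤ → A) := fun i hi s hs =>
    per_mono (pow_dvd_pow p ((Finset.le_sup (f := e)
      (Finset.mem_Icc.2 (abs_le.1 hs))).trans hi)) _ (he s)
  -- The extra `1` ensures `i ≥ 1`, where `hx.block` applies.
  refine ⟨K + 1, fun i hi n hn => mem_per_iff.2 fun m hm => ?_⟩
  have hval : ∀ k : ℤ, (π x : ℤ → B) k =
      (π ⟨shift k (x : ℤ → A), X.mapsTo k x.2⟩ : ℤ → B) 0 := fun k => by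
    rw [h.apply_shift x k]
    simp
  rw [hval, hval]
  refine hF _ _ fun s hs => ?_
  have hs' := abs_le.1 (hM s hs)
  change (x : ℤ → A) (m + s) = (x : ℤ → A) (n + s)
  refine mem_per_iff.1 ?_ _ (hm.add_right s)
  have hn' : (n : ℤ) < ((p ^ i : ℕ) : ℤ) := by exact_mod_cast hn
  -- The window leaves `[0, p^i)` by at most `M`: on the left it stays within `M` of `0`, on the
  -- right it does so after translation by `-p^i`.
  rcases lt_or_ge ((n : ℤ) + s) 0 with h0 | h0
  · exact hK _ (by omega) _ (abs_le.2 ⟨by omega, by omega⟩)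
  rcases lt_or_ge ((n : ℤ) + s) ((p ^ i : ℕ) : ℤ) with h1 | h1
  · obtain ⟨k, hk⟩ := Int.eq_ofNat_of_zero_le h0
    rw [hk] at h1 ⊢
    exact (hx.block i (by omega)).mem_per (by exact_mod_cast h1)
  · refine per_mono (pow_dvd_pow p (Nat.le_succ i)) _
      (mem_per_of_modEq (hK i (by omega) ((n : ℤ) + s - ((p ^ i : ℕ) : ℤ))
        (abs_le.2 ⟨by omega, by omega⟩)) (Int.modEq_iff_dvd.2 ⟨-1, by ring⟩))

theorem IsFactorMap.dvd [Finite A] [DiscreteTopology A] [DiscreteTopology B]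
    {X : Subshift A ℤ} {Y : Subshift B ℤ} {π : X.carrier → Y.carrier} (h : IsFactorMap X Y π)
    {x : X.carrier} {y : Y.carrier} (hxy : π x = y) {p q : ℕ}
    (hx : Aperiodic (x : ℤ → A)) (hy : Aperiodic (y : ℤ → B))
    (hp : IsConstructive (x : ℤ → A) fun i => p ^ i)
    (hq : IsConstructive (y : ℤ → B) fun i => q ^ i) : q ∣ p := by
  subst hxy
  exact hq.dvd_of_eventuallyCovers hy (hp.two_le hx) (h.eventuallyCovers hp)

end Topology

end ToeplitzShift

theorem theorem1p1 {A B : Type*}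
    [Finite A] [TopologicalSpace A] [DiscreteTopology A]
    [Finite B] [TopologicalSpace B] [DiscreteTopology B]
    (X : Subshift A ℤ) (Y : Subshift B ℤ)
    (hX : ToeplitzShift.IsToeplitzShift X) (hY : ToeplitzShift.IsToeplitzShift Y)
    (x : X.carrier) (y : Y.carrier)
    (hx : ToeplitzShift.IsToeplitzSequence (x : ℤ → A))
    (hy : ToeplitzShift.IsToeplitzSequence (y : ℤ → B))
    (p q : ℕ)
    (hp : ToeplitzShift.IsConstructive (x : ℤ → A) (fun i => p ^ i))
    (hq : ToeplitzShift.IsConstructive (y : ℤ → B) (fun i => q ^ i)) :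
    (∀ π : X.carrier → Y.carrier,
        ToeplitzShift.IsFactorMap X Y π → π x = y → q ∣ p) ∧
      (∀ π : X.carrier → Y.carrier,
        ToeplitzShift.IsConjugacy X Y π → π x = y → p = q) := by
  refine ⟨fun π hπ hxy => hπ.dvd hxy hx.1 hy.1 hp hq, fun π hπ hxy => ?_⟩
  let φ : X.carrier ≃ₜ Y.carrier := hπ.homeomorph.homeomorph
  have h1 : ToeplitzShift.IsFactorMap X Y π :=
    ⟨hπ.homeomorph.continuous, hπ.homeomorph.surjective, hπ.semiconj⟩
  have h2 : ToeplitzShift.IsFactorMap Y X φ.symm :=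
    ⟨φ.symm.continuous, φ.symm.surjective,
      hπ.semiconj.inverse_left φ.left_inv φ.right_inv⟩
  have hyx : φ.symm y = x := by
    rw [φ.symm_apply_eq]
    exact hxy.symm
  exact Nat.dvd_antisymm (h2.dvd hyx hy.1 hx.1 hq hp) (h1.dvd hxy hx.1 hy.1 hp hq)
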